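/- Let $\mathcal D$ be a nonempty set (finite or infinite). Let $\mathcal T$ be the set of plane rooted trees with vertices decorated by elements of $\mathcal D$, and let $\mathcal F$ be the set of plane forests, i.e. finite sequences $t_1\cdots t_n$ of elements of $\mathcal T$, including the empty forest $1$. Edges are oriented away from the roots. Let $\mathcal H$ be the free associative unital $\mathbb Q$-algebra generated by $\mathcal T$; its monomials are the forests. Define linear maps by their values on forests as follows. * $\Delta:\mathcal H\to\mathcal H\otimes\mathcal H$, $\Delta(F)=\sum_{c} P^c(F)\otimes R^c(F)$, the sum over all admissible cuts $c$ of $F$. An admissible cut of $F=t_1\cdots t_n$ is a tuple $(c_1,\dots,c_n)$ in which each $c_i$ is either a (possibly empty) set of edges of $t_i$ such that every oriented path of $t_i$ contains at most one of them, or the total cut of $t_i$. In the first case $R^{c_i}(t_i)$ is the component of the root of $t_i$ after deletion of the edges in $c_i$, and $P^{c_i}(t_i)$ is the plane forest of the other components, taken from left to right; for the total cut, $P^{c_i}(t_i)=t_i$ and $R^{c_i}(t_i)=1$. Then $P^c(F)=P^{c_1}(t_1)\cdots P^{c_n}(t_n)$ and $R^c(F)=R^{c_1}(t_1)\cdots R^{c_n}(t_n)$.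 * $\varepsilon:\mathcal H\to\mathbb Q$, $\varepsilon(1)=1$ and $\varepsilon(F)=0$ for $F\ne 1$. * For $d\in\mathcal D$, $B_d^+(t_1\cdots t_n)$ is the tree obtained by joining the roots of $t_1,\dots,t_n$, in this order, to a common root decorated by $d$. * For $d\in\mathcal D$, $\gamma_d(1)=0$, and $\gamma_d(t_1\cdots t_n)=t_1\cdots t_{n-1}$ if $t_n$ is the single vertex decorated by $d$, and $0$ otherwise. Let $(\cdot,\cdot)$ be the unique bilinear form on $\mathcal H$ such that, for all $x,x_1,x_2,y\in\mathcal H$ and $d\in\mathcal D$, $(1,y)=\varepsilon(y)$, $(x_1x_2,y)=(x_1\otimes x_2,\Delta(y))$ and $(B_d^+(x),y)=(x,\gamma_d(y))$, where $(x_1\otimes x_2,y_1\otimes y_2)=(x_1,y_1)(x_2,y_2)$. For $F\in\mathcal F$ let $\mathrm{som}(F)$ be its set of vertices. For $x,y\in\mathrm{som}(F)$ write $x\ge_{haut}y$ if there is an oriented path (possibly of length $0$) from $y$ to $x$. The partial order $\ge_{gauche}$ on $\mathrm{som}(F)$, $F=t_1\cdots t_n$, is the reflexive relation defined recursively for distinct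 vertices $x$ of $t_i$ and $y$ of $t_j$: if $i<j$ then $x\ge_{gauche}y$; if $i>j$ then $y\ge_{gauche}x$; if $i=j$ and $x$ or $y$ is the root of $t_i$, then $x$ and $y$ are not comparable; if $i=j$ and neither is the root of $t_i$, then they are compared in the forest obtained from $t_i$ by deleting its root. For $F,G\in\mathcal F$, let $\mathcal I(F,G)$ be the set of bijections $f:\mathrm{som}(F)\to\mathrm{som}(G)$ such that 1. for all $x,y\in\mathrm{som}(F)$, $x\ge_{haut}y$ implies $f(x)\ge_{gauche}f(y)$; 2. for all $x,y\in\mathrm{som}(F)$, $f(x)\ge_{haut}f(y)$ implies $x\ge_{gauche}y$; 3. for all $x\in\mathrm{som}(F)$, $x$ and $f(x)$ have the same decoration. Then $(F,G)=\operatorname{card}(\mathcal I(F,G))$ for all $F,G\in\mathcal F$. -/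

import Mathlib

open scoped TensorProduct

/-- Plane rooted trees with vertices decorated by `D`: `node d [t₁, …, tₙ]` is the tree
`B_d⁺(t₁ ⋯ tₙ)` with root decorated by `d` whose children, from left to right, are the roots of
`t₁, …, tₙ`. -/
inductive PTree (D : Type*) : Type _
  | node (d : D) (children : List (PTree D)) : PTree D

/-- Plane forests: finite sequences `t₁ ⋯ tₙ` of plane trees (the empty forest is `[]`). -/
abbrev PForest (D : Type*) : Type _ := List (PTree D)

namespace PForest

/-- Induction on plane forests. -/
theorem ind {D : Type*} {motive : PForest D → Prop} (nil : motive [])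
    (cons : ∀ (d : D) (G F : PForest D), motive G → motive F → motive (PTree.node d G :: F)) :
    ∀ F : PForest D, motive F
  | [] => nil
  | PTree.node d G :: F => cons d G F (ind nil cons G) (ind nil cons F)

/-- The set `som(F)` of vertices of a forest `F`. The vertices of `B_d⁺(G) F` are the root of the
first tree, the vertices of `G`, and the vertices of `F`. -/
inductive Som {D : Type*} : PForest D → Type _
  | root {d : D} {G F : PForest D} : Som (PTree.node d G :: F)
  | child {d : D} {G F : PForest D} (x : Som G) : Som (PTree.node d G :: F)
  | tail {d : D} {G F : PForest D} (x : Som F) : Som (PTree.node d G :: F)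

namespace Som

/-- The decoration of a vertex. -/
def deco {D : Type*} : {F : PForest D} → Som F → D
  | PTree.node d _ :: _, root => d
  | PTree.node _ _ :: _, child x => deco x
  | PTree.node _ _ :: _, tail x => deco x

/-- The vertex is the root of one of the trees of the forest. -/
def IsRoot {D : Type*} : {F : PForest D} → Som F → Prop
  | PTree.node _ _ :: _, root => True
  | PTree.node _ _ :: _, child _ => False
  | PTree.node _ _ :: _, tail x => IsRoot x

/-- `Edge y x`: there is an (oriented, upwards) edge from the vertex `y` to the vertex `x`. -/
def Edge {D : Type*} : {F : PForest D} → Som F → Som F → Prop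
  | PTree.node _ _ :: _, root, root => False
  | PTree.node _ _ :: _, root, child x => IsRoot x
  | PTree.node _ _ :: _, root, tail _ => False
  | PTree.node _ _ :: _, child _, root => False
  | PTree.node _ _ :: _, child y, child x => Edge y x
  | PTree.node _ _ :: _, child _, tail _ => False
  | PTree.node _ _ :: _, tail _, root => False
  | PTree.node _ _ :: _, tail _, child _ => False
  | PTree.node _ _ :: _, tail y, tail x => Edge y x

/-- `x ≥_haut y`: there is a path from `y` to `x` in the oriented graph `F`. -/
def Haut {D : Type*} {F : PForest D} (x y : Som F) : Prop :=
  Relation.ReflTransGen Edge y x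

/-- `x ≥_gauche y`. Two distinct vertices in distinct trees `tᵢ`, `tⱼ` with `i < j` satisfy
`x ≥_gauche y` if `x ∈ tᵢ` and `y ∈ tⱼ`; the root of a tree is not comparable to the other vertices
of this tree; two vertices of the same tree other than its root are compared in the forest
obtained by deleting the root. -/
def Gauche {D : Type*} : {F : PForest D} → Som F → Som F → Prop
  | PTree.node _ _ :: _, root, root => True
  | PTree.node _ _ :: _, root, child _ => False
  | PTree.node _ _ :: _, root, tail _ => True
  | PTree.node _ _ :: _, child _, root => False
  | PTree.node _ _ :: _, child x, child y => Gauche x y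
  | PTree.node _ _ :: _, child _, tail _ => True
  | PTree.node _ _ :: _, tail _, root => False
  | PTree.node _ _ :: _, tail _, child _ => False
  | PTree.node _ _ :: _, tail x, tail y => Gauche x y

end Som

/-- A cut of a forest is encoded as a set of vertices: a vertex other than a root stands for the cut
of the unique edge arriving at this vertex, and the root of a tree `tᵢ` stands for the total cut of
`tᵢ`. The cut is admissible if no path in the forest meets two of its elements, that is, if no two
distinct elements are comparable for `≥_haut`; in particular a tree that is cut totally carries no
other cut. The empty set is the empty cut. -/
def AdmissibleCut {D : Type*} (F : PForest D) : Type _ :=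
  {c : Set (Som F) // IsAntichain Som.Haut c}

open Classical in
/-- `P^c(F)`: the plane forest of the trees that the cut `c` separates from the roots. -/
noncomputable def pruned {D : Type*} : (F : PForest D) → Set (Som F) → PForest D
  | [], _ => []
  | PTree.node d G :: F, c =>
    (if Som.root ∈ c then [PTree.node d G] else pruned G {x | Som.child x ∈ c}) ++
      pruned F {x | Som.tail x ∈ c}

open Classical in
/-- `R^c(F)`: the plane forest of the components of the roots that remain after the cut `c`. -/
noncomputable def trunk {D : Type*} : (F : PForest D) → Set (Som F) → PForest D
  | [], _ => []
  | PTree.node d G :: F, c =>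
    (if Som.root ∈ c then [] else [PTree.node d (trunk G {x | Som.child x ∈ c})]) ++
      trunk F {x | Som.tail x ∈ c}

instance finite_som {D : Type*} (F : PForest D) : Finite (Som F) := by
  induction F using ind with
  | nil =>
    have : IsEmpty (Som ([] : PForest D)) := ⟨fun x => nomatch x⟩
    infer_instance
  | cons d G F hG hF =>
    refine Finite.of_surjective
      (fun z : Option (Som G) ⊕ Som F => (match z with
        | .inl none => Som.root
        | .inl (some x) => Som.child x
        | .inr x => Som.tail x : Som (PTree.node d G :: F))) ?_
    intro x
    cases x with
    | root => exact ⟨.inl none, rfl⟩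
    | child x => exact ⟨.inl (some x), rfl⟩
    | tail x => exact ⟨.inr x, rfl⟩

noncomputable instance fintype_admissibleCut {D : Type*} (F : PForest D) :
    Fintype (AdmissibleCut F) :=
  have : Finite (AdmissibleCut F) := Subtype.finite
  Fintype.ofFinite _

/-- The algebra `H` of plane decorated rooted trees: the free associative unital algebra over `ℚ`
on the set of trees. Its monomials are the plane forests. -/
abbrev H (D : Type*) : Type _ := MonoidAlgebra ℚ (FreeMonoid (PTree D))

/-- A plane forest as a monomial of `H`. -/
noncomputable def mono {D : Type*} (F : PForest D) : H D :=
  MonoidAlgebra.single (FreeMonoid.ofList F) 1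

/-- The linear map on `H` with prescribed values on forests. -/
noncomputable def linExt {D V : Type*} [AddCommGroup V] [Module ℚ V] (f : PForest D → V) :
    H D →ₗ[ℚ] V :=
  (MonoidAlgebra.basis (FreeMonoid (PTree D)) ℚ).constr ℚ fun F => f F.toList

/-- The coproduct `Δ(F) = ∑_c P^c(F) ⊗ R^c(F)`, the sum over all admissible cuts of `F`, including
the empty one and the total one. -/
noncomputable def coprod (D : Type*) : H D →ₗ[ℚ] H D ⊗[ℚ] H D :=
  linExt fun F => ∑ c : AdmissibleCut F, mono (pruned F c.1) ⊗ₜ[ℚ] mono (trunk F c.1)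

open Classical in
/-- The counit: `ε(1) = 1` and `ε(F) = 0` for every nonempty forest `F`. -/
noncomputable def counit (D : Type*) : H D →ₗ[ℚ] ℚ :=
  linExt fun F => if F = [] then 1 else 0

/-- `B_d⁺` sends a forest `t₁ ⋯ tₙ` to the tree with root decorated by `d` and branches
`t₁, …, tₙ`. -/
noncomputable def bPlus {D : Type*} (d : D) : H D →ₗ[ℚ] H D :=
  linExt fun F => mono [PTree.node d F]

open Classical in
/-- `γ_d(t₁ ⋯ tₙ) = t₁ ⋯ tₙ₋₁` if `tₙ` is the single vertex decorated by `d`, and `0` otherwise;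
`γ_d(1) = 0`. -/
noncomputable def gamma {D : Type*} (d : D) : H D →ₗ[ℚ] H D :=
  linExt fun F => if F.getLast? = some (PTree.node d []) then mono F.dropLast else 0

/-- The three properties that characterize the bilinear form `( , )` on `H`, where
`(x₁ ⊗ x₂, y₁ ⊗ y₂) = (x₁, y₁) (x₂, y₂)`. -/
structure IsPairing {D : Type*} (B : LinearMap.BilinForm ℚ (H D)) : Prop where
  one_left : ∀ y, B 1 y = counit D y
  mul_left : ∀ x₁ x₂ y, B (x₁ * x₂) y = B.tmul B (x₁ ⊗ₜ[ℚ] x₂) (coprod D y)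
  bPlus_left : ∀ (d : D) (x y), B (bPlus d x) y = B x (gamma d y)

section Existence

variable {D : Type*}

theorem linExt_mono {V : Type*} [AddCommGroup V] [Module ℚ V] (f : PForest D → V)
    (F : PForest D) : linExt f (mono F) = f F := by
  have h : mono F = MonoidAlgebra.basis (FreeMonoid (PTree D)) ℚ (FreeMonoid.ofList F) := rfl
  rw [h, linExt, Module.Basis.constr_basis]
  rfl

theorem hom_ext {V : Type*} [AddCommGroup V] [Module ℚ V] {f g : H D →ₗ[ℚ] V}
    (h : ∀ F : PForest D, f (mono F) = g (mono F)) : f = g :=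
  (MonoidAlgebra.basis (FreeMonoid (PTree D)) ℚ).ext fun F => h F.toList

theorem mono_nil : mono ([] : PForest D) = 1 := rfl

theorem mono_append (F G : PForest D) : mono (F ++ G) = mono F * mono G := by
  simp [mono, MonoidAlgebra.single_mul_single]

theorem haut_child_iff {d : D} {G F : PForest D} {x y : Som G} :
    Som.Haut (Som.child x : Som (PTree.node d G :: F)) (Som.child y) ↔ Som.Haut x y := by
  constructor
  · have key : ∀ z : Som (PTree.node d G :: F), Relation.ReflTransGen Som.Edge (Som.child y) z →
        ∃ x, z = Som.child x ∧ Relation.ReflTransGen Som.Edge y x := by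
      intro z hz
      induction hz with
      | refl => exact ⟨y, rfl, .refl⟩
      | @tail b c _ hbc ih =>
        obtain ⟨x, rfl, hx⟩ := ih
        cases c with
        | root => simp [Som.Edge] at hbc
        | child x' => exact ⟨x', rfl, hx.tail (by simpa [Som.Edge] using hbc)⟩
        | tail x' => simp [Som.Edge] at hbc
    intro h
    obtain ⟨x', h1, h2⟩ := key _ h
    cases h1
    exact h2
  · intro h
    exact Relation.ReflTransGen.lift (r := Som.Edge) (p := Som.Edge)
      (Som.child : Som G → Som (PTree.node d G :: F)) (fun a b hab => by simpa [Som.Edge] using hab) _ _ h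

theorem haut_tail {d : D} {G F : PForest D} {y : Som F} (z : Som (PTree.node d G :: F))
    (hz : Relation.ReflTransGen Som.Edge (Som.tail y) z) :
    ∃ x, z = Som.tail x ∧ Relation.ReflTransGen Som.Edge y x := by
  induction hz with
  | refl => exact ⟨y, rfl, .refl⟩
  | @tail b c _ hbc ih =>
    obtain ⟨x, rfl, hx⟩ := ih
    cases c with
    | root => simp [Som.Edge] at hbc
    | child x' => simp [Som.Edge] at hbc
    | tail x' => exact ⟨x', rfl, hx.tail (by simpa [Som.Edge] using hbc)⟩

theorem haut_tail_iff {d : D} {G F : PForest D} {x y : Som F} :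
    Som.Haut (Som.tail x : Som (PTree.node d G :: F)) (Som.tail y) ↔ Som.Haut x y := by
  constructor
  · intro h
    obtain ⟨x', h1, h2⟩ := haut_tail _ h
    cases h1
    exact h2
  · intro h
    exact Relation.ReflTransGen.lift (r := Som.Edge) (p := Som.Edge)
      (Som.tail : Som F → Som (PTree.node d G :: F)) (fun a b hab => by simpa [Som.Edge] using hab) _ _ h

theorem not_haut_tail {d : D} {G F : PForest D} (x : Som F) (y : Som (PTree.node d G :: F))
    (hy : ∀ z, y ≠ Som.tail z) : ¬ Som.Haut (Som.tail x) y := by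
  have key : ∀ z : Som (PTree.node d G :: F), Relation.ReflTransGen Som.Edge y z →
      ∀ x, z ≠ Som.tail x := by
    intro z hz
    induction hz with
    | refl => exact hy
    | @tail b c _ hbc ih =>
      rintro x rfl
      cases b with
      | root => simp [Som.Edge] at hbc
      | child x' => simp [Som.Edge] at hbc
      | tail x' => exact ih _ rfl
  exact fun h => key _ h x rfl

theorem not_haut_of_tail {d : D} {G F : PForest D} (x : Som F) (y : Som (PTree.node d G :: F))
    (hy : ∀ z, y ≠ Som.tail z) : ¬ Som.Haut y (Som.tail x) := by
  intro h
  obtain ⟨x', h1, -⟩ := haut_tail _ h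
  exact hy _ h1

theorem exists_isRoot {F : PForest D} (x : Som F) :
    ∃ r : Som F, r.IsRoot ∧ Relation.ReflTransGen Som.Edge r x := by
  induction x with
  | root => exact ⟨.root, by simp [Som.IsRoot], .refl⟩
  | @child d G F x ih =>
    obtain ⟨r, hr, h⟩ := ih
    refine ⟨.root, by simp [Som.IsRoot], .head (b := .child r) (by simpa [Som.Edge] using hr) ?_⟩
    exact haut_child_iff.2 h
  | tail x ih =>
    obtain ⟨r, hr, h⟩ := ih
    exact ⟨.tail r, by simpa [Som.IsRoot] using hr, haut_tail_iff.2 h⟩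

theorem haut_root {d : D} {G F : PForest D} (x : Som G) :
    Som.Haut (Som.child x : Som (PTree.node d G :: F)) Som.root := by
  obtain ⟨r, hr, h⟩ := exists_isRoot x
  exact Relation.ReflTransGen.head (b := Som.child r) (by simpa [Som.Edge] using hr)
    (haut_child_iff.2 h)

theorem isAntichain_cons {d : D} {G F : PForest D} (c : Set (Som (PTree.node d G :: F))) :
    IsAntichain Som.Haut c ↔
      IsAntichain Som.Haut {x | Som.child x ∈ c} ∧ IsAntichain Som.Haut {x | Som.tail x ∈ c} ∧
        (Som.root ∈ c → ∀ x, Som.child x ∉ c) := by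
  constructor
  · intro h
    refine ⟨fun x hx y hy hxy hh => ?_, fun x hx y hy hxy hh => ?_, fun hr x hx => ?_⟩
    · exact h hx hy (by simpa using hxy) (haut_child_iff.2 hh)
    · exact h hx hy (by simpa using hxy) (haut_tail_iff.2 hh)
    · exact h hx hr (by simp) (haut_root x)
  · rintro ⟨h1, h2, h3⟩ x hx y hy hxy hh
    cases x with
    | root =>
      cases y with
      | root => exact hxy rfl
      | child y => exact h3 hx _ hy
      | tail y => exact not_haut_of_tail y .root (by simp) hh
    | child x =>
      cases y with
      | root => exact h3 hy _ hx
      | child y => exact h1 hx hy (by simpa using hxy) (haut_child_iff.1 hh)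
      | tail y => exact not_haut_of_tail y (.child x) (by simp) hh
    | tail x =>
      cases y with
      | root => exact not_haut_tail x .root (by simp) hh
      | child y => exact not_haut_tail x (.child y) (by simp) hh
      | tail y => exact h2 hx hy (by simpa using hxy) (haut_tail_iff.1 hh)

/-- An admissible cut of `B_d⁺(G) F` is an admissible cut of `F` together with either the total cut
of the first tree or an admissible cut of `G`. -/
noncomputable def cutEquiv (d : D) (G F : PForest D) :
    Option (AdmissibleCut G) × AdmissibleCut F ≃ AdmissibleCut (PTree.node d G :: F) := by
  refine Equiv.ofBijective (fun p => ⟨{x | match x with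
    | .root => p.1 = none
    | .child x => ∃ a, p.1 = some a ∧ x ∈ a.1
    | .tail x => x ∈ p.2.1}, ?_⟩) ⟨?_, ?_⟩
  · rw [isAntichain_cons]
    refine ⟨?_, p.2.2, ?_⟩
    · intro x hx y hy
      obtain ⟨a, ha, hx⟩ := hx
      obtain ⟨b, hb, hy⟩ := hy
      rw [ha] at hb
      cases hb
      exact a.2 hx hy
    · rintro hr x ⟨a, ha, -⟩
      exact absurd (ha.symm.trans hr) (by simp)
  · rintro ⟨o, c⟩ ⟨o', c'⟩ h
    have h0 := fun x => Set.ext_iff.1 (congrArg Subtype.val h) x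
    have hc : c = c' := Subtype.ext (Set.ext fun x => h0 (.tail x))
    have hr : o = none ↔ o' = none := h0 .root
    subst hc
    cases o with
    | none => rw [hr.1 rfl]
    | some a =>
      cases o' with
      | none => exact absurd (hr.2 rfl) (by simp)
      | some b =>
        have : a = b := Subtype.ext (Set.ext fun x => by
          have := h0 (.child x)
          simpa using this)
        rw [this]
  · rintro ⟨c, hc⟩
    obtain ⟨h1, h2, h3⟩ := (isAntichain_cons c).1 hc
    by_cases hr : Som.root ∈ c
    · refine ⟨(none, ⟨_, h2⟩), Subtype.ext (Set.ext fun x => ?_)⟩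
      cases x with
      | root => simpa using hr
      | child x => simpa using h3 hr x
      | tail x => simp
    · refine ⟨(some ⟨_, h1⟩, ⟨_, h2⟩), Subtype.ext (Set.ext fun x => ?_)⟩
      cases x with
      | root => simpa using hr
      | child x => exact ⟨fun ⟨a, ha, hx⟩ => by cases ha; exact hx, fun hx => ⟨_, rfl, hx⟩⟩
      | tail x => simp

theorem cutEquiv_root (d : D) (G F : PForest D) (p : Option (AdmissibleCut G) × AdmissibleCut F) :
    Som.root ∈ (cutEquiv d G F p).1 ↔ p.1 = none := Iff.rfl

theorem cutEquiv_child (d : D) (G F : PForest D) (a : AdmissibleCut G) (c : AdmissibleCut F) :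
    {x | Som.child x ∈ (cutEquiv d G F (some a, c)).1} = a.1 :=
  Set.ext fun _ => ⟨fun ⟨b, hb, hx⟩ => by cases hb; exact hx, fun hx => ⟨_, rfl, hx⟩⟩

theorem cutEquiv_tail (d : D) (G F : PForest D)
    (p : Option (AdmissibleCut G) × AdmissibleCut F) :
    {x | Som.tail x ∈ (cutEquiv d G F p).1} = p.2.1 := rfl

theorem coprod_nil : coprod D 1 = 1 := by
  have hu : Unique (AdmissibleCut ([] : PForest D)) :=
    ⟨⟨⟨∅, by simp⟩⟩, fun c => Subtype.ext (Set.ext fun x => nomatch x)⟩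
  rw [← mono_nil, coprod, linExt_mono, Fintype.sum_unique]
  simp [pruned, trunk, mono_nil, Algebra.TensorProduct.one_def]

theorem coprod_cons (d : D) (G F : PForest D) :
    coprod D (mono (PTree.node d G :: F)) =
      (mono [PTree.node d G] ⊗ₜ[ℚ] 1 + (bPlus d).lTensor (H D) (coprod D (mono G))) *
        coprod D (mono F) := by
  simp only [coprod, linExt_mono]
  rw [← (cutEquiv d G F).sum_comp, Fintype.sum_prod_type, Fintype.sum_option, add_mul, map_sum,
    Finset.mul_sum, Finset.sum_mul_sum]
  congr 1
  · refine Finset.sum_congr rfl fun c _ => ?_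
    simp [cutEquiv_root, cutEquiv_tail, pruned, trunk, ← mono_append]
  · refine Finset.sum_congr rfl fun a _ => Finset.sum_congr rfl fun c _ => ?_
    simp [cutEquiv_root, cutEquiv_child, cutEquiv_tail, pruned, trunk, ← mono_append, bPlus, linExt_mono]

theorem coprod_bPlus (d : D) (x : H D) :
    coprod D (bPlus d x) = bPlus d x ⊗ₜ[ℚ] 1 + (bPlus d).lTensor (H D) (coprod D x) := by
  have : coprod D ∘ₗ bPlus d = (TensorProduct.mk ℚ (H D) (H D)).flip 1 ∘ₗ bPlus d +
      (bPlus d).lTensor (H D) ∘ₗ coprod D := hom_ext fun F => by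
    have h := coprod_cons d F []
    rw [mono_nil, coprod_nil, mul_one] at h
    simpa [bPlus, linExt_mono] using h
  simpa using LinearMap.congr_fun this x

theorem mono_cons (d : D) (G F : PForest D) :
    mono (PTree.node d G :: F) = bPlus d (mono G) * mono F := by
  rw [bPlus, linExt_mono, ← mono_append]
  rfl

theorem coprod_mul (x y : H D) : coprod D (x * y) = coprod D x * coprod D y := by
  have key : (LinearMap.mul ℚ (H D)).compr₂ (coprod D) =
      (LinearMap.mul ℚ (H D ⊗[ℚ] H D)).compl₁₂ (coprod D) (coprod D) := by
    refine hom_ext fun F => hom_ext fun G => ?_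
    simp only [LinearMap.compr₂_apply, LinearMap.mul_apply', LinearMap.compl₁₂_apply]
    induction F using ind with
    | nil => simp [mono_nil, coprod_nil]
    | cons d A F _ ih =>
      rw [← mono_append, List.cons_append, coprod_cons, mono_append, ih, coprod_cons, mul_assoc]
  simpa using LinearMap.congr_fun₂ key x y

/-- The coproduct as a morphism of algebras. -/
noncomputable def coprodHom (D : Type*) : H D →ₐ[ℚ] H D ⊗[ℚ] H D :=
  AlgHom.ofLinearMap (coprod D) coprod_nil coprod_mul

theorem coassoc (x : H D) :
    TensorProduct.assoc ℚ (H D) (H D) (H D) ((coprod D).rTensor (H D) (coprod D x)) =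
      (coprod D).lTensor (H D) (coprod D x) := by
  let f : H D →ₐ[ℚ] H D ⊗[ℚ] (H D ⊗[ℚ] H D) :=
    ((Algebra.TensorProduct.assoc ℚ ℚ ℚ (H D) (H D) (H D)).toAlgHom.comp
      (Algebra.TensorProduct.map (coprodHom D) (AlgHom.id ℚ (H D)))).comp (coprodHom D)
  let g : H D →ₐ[ℚ] H D ⊗[ℚ] (H D ⊗[ℚ] H D) :=
    (Algebra.TensorProduct.map (AlgHom.id ℚ (H D)) (coprodHom D)).comp (coprodHom D)
  have hf : ∀ x, f x =
      TensorProduct.assoc ℚ (H D) (H D) (H D) ((coprod D).rTensor (H D) (coprod D x)) :=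
    fun x => rfl
  have hg : ∀ x, g x = (coprod D).lTensor (H D) (coprod D x) := fun x => rfl
  have h1 : ∀ (d : D) (z : H D ⊗[ℚ] H D),
      (coprod D).lTensor (H D) ((bPlus d).lTensor (H D) z) =
        TensorProduct.assoc ℚ (H D) (H D) (H D) ((bPlus d).lTensor (H D) z ⊗ₜ[ℚ] 1) +
        ((bPlus d).lTensor (H D)).lTensor (H D) ((coprod D).lTensor (H D) z) := by
    intro d z
    induction z using TensorProduct.induction_on with
    | zero => simp
    | add a b ha hb => simp only [map_add, ha, hb, TensorProduct.add_tmul]; abel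
    | tmul a b => simp [coprod_bPlus, TensorProduct.tmul_add]
  have h2 : ∀ (d : D) (z : H D ⊗[ℚ] H D),
      TensorProduct.assoc ℚ (H D) (H D) (H D)
        ((coprod D).rTensor (H D) ((bPlus d).lTensor (H D) z)) =
      ((bPlus d).lTensor (H D)).lTensor (H D)
        (TensorProduct.assoc ℚ (H D) (H D) (H D) ((coprod D).rTensor (H D) z)) := by
    intro d z
    induction z using TensorProduct.induction_on with
    | zero => simp
    | add a b ha hb => simp only [map_add, ha, hb]
    | tmul a b =>
      simp only [LinearMap.lTensor_tmul, LinearMap.rTensor_tmul]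
      generalize coprod D a = w
      induction w using TensorProduct.induction_on with
      | zero => simp
      | add a b ha hb => simp only [map_add, ha, hb, TensorProduct.add_tmul]
      | tmul a' b' => simp
  have key : f.toLinearMap = g.toLinearMap := by
    refine hom_ext fun F => ?_
    simp only [AlgHom.toLinearMap_apply]
    induction F using ind with
    | nil => exact f.map_one.trans g.map_one.symm
    | cons d G F hG hF =>
      rw [mono_cons, map_mul, map_mul, hF]
      congr 1
      rw [hf, hg] at hG ⊢
      rw [coprod_bPlus]
      simp only [map_add, h1, h2, hG, LinearMap.rTensor_tmul, LinearMap.lTensor_tmul, coprod_nil,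
        coprod_bPlus, TensorProduct.add_tmul, TensorProduct.assoc_tmul,
        Algebra.TensorProduct.one_def, add_assoc]
  exact LinearMap.congr_fun key x

/-- The counit as a morphism of algebras. -/
noncomputable def counitHom (D : Type*) : H D →ₐ[ℚ] ℚ :=
  AlgHom.ofLinearMap (counit D) (by simp [← mono_nil, counit, linExt_mono]) (by
    have : (LinearMap.mul ℚ (H D)).compr₂ (counit D) =
        (LinearMap.mul ℚ ℚ).compl₁₂ (counit D) (counit D) := by
      refine hom_ext fun F => hom_ext fun G => ?_
      simp only [LinearMap.compr₂_apply, LinearMap.mul_apply', LinearMap.compl₁₂_apply,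
        ← mono_append]
      by_cases hF : F = [] <;> by_cases hG : G = [] <;> simp [counit, linExt_mono, hF, hG]
    exact fun x y => by simpa using LinearMap.congr_fun₂ this x y)

theorem counit_bPlus (d : D) (x : H D) : counit D (bPlus d x) = 0 := by
  have : counit D ∘ₗ bPlus d = 0 := hom_ext fun F => by simp [bPlus, counit, linExt_mono]
  exact LinearMap.congr_fun this x

theorem counit_left (x : H D) :
    TensorProduct.lid ℚ (H D) ((counit D).rTensor (H D) (coprod D x)) = x := by
  let f : H D →ₐ[ℚ] H D := ((Algebra.TensorProduct.lid ℚ (H D)).toAlgHom.comp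
    (Algebra.TensorProduct.map (counitHom D) (AlgHom.id ℚ (H D)))).comp (coprodHom D)
  have hf : ∀ x, f x = TensorProduct.lid ℚ (H D) ((counit D).rTensor (H D) (coprod D x)) :=
    fun x => rfl
  have hb : ∀ (d : D) (z : H D ⊗[ℚ] H D),
      TensorProduct.lid ℚ (H D) ((counit D).rTensor (H D) ((bPlus d).lTensor (H D) z)) =
        bPlus d (TensorProduct.lid ℚ (H D) ((counit D).rTensor (H D) z)) := by
    intro d z
    induction z using TensorProduct.induction_on with
    | zero => simp
    | add a b ha hb => simp only [map_add, ha, hb]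
    | tmul a b => simp
  have key : f.toLinearMap = LinearMap.id := by
    refine hom_ext fun F => ?_
    simp only [AlgHom.toLinearMap_apply, LinearMap.id_apply]
    induction F using ind with
    | nil => exact f.map_one
    | cons d G F hG hF =>
      rw [mono_cons, map_mul, hF]
      congr 1
      rw [hf] at hG ⊢
      rw [coprod_bPlus, map_add, map_add, hb, hG]
      simp [counit_bPlus]
  exact LinearMap.congr_fun key x

theorem counit_right (x : H D) :
    TensorProduct.rid ℚ (H D) ((counit D).lTensor (H D) (coprod D x)) = x := by
  let f : H D →ₐ[ℚ] H D := ((Algebra.TensorProduct.rid ℚ ℚ (H D)).toAlgHom.comp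
    (Algebra.TensorProduct.map (AlgHom.id ℚ (H D)) (counitHom D))).comp (coprodHom D)
  have hf : ∀ x, f x = TensorProduct.rid ℚ (H D) ((counit D).lTensor (H D) (coprod D x)) :=
    fun x => rfl
  have hb : ∀ (d : D) (z : H D ⊗[ℚ] H D),
      (counit D).lTensor (H D) ((bPlus d).lTensor (H D) z) = 0 := by
    intro d z
    induction z using TensorProduct.induction_on with
    | zero => simp
    | add a b ha hb => simp only [map_add, ha, hb, add_zero]
    | tmul a b => simp [counit_bPlus]
  have h1 : counit D 1 = 1 := (counitHom D).map_one
  have key : f.toLinearMap = LinearMap.id := by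
    refine hom_ext fun F => ?_
    simp only [AlgHom.toLinearMap_apply, LinearMap.id_apply]
    induction F using ind with
    | nil => exact f.map_one
    | cons d G F hG hF =>
      rw [mono_cons, map_mul, hF]
      congr 1
      rw [hf, coprod_bPlus, map_add, hb]
      simp [h1]
  exact LinearMap.congr_fun key x

/-- The product of linear forms on `H` dual to the coproduct. -/
noncomputable def conv (f g : H D →ₗ[ℚ] ℚ) : H D →ₗ[ℚ] ℚ :=
  LinearMap.mul' ℚ ℚ ∘ₗ TensorProduct.map f g ∘ₗ coprod D

theorem conv_assoc (f g h : H D →ₗ[ℚ] ℚ) : conv (conv f g) h = conv f (conv g h) := by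
  have h1 : ∀ z : H D ⊗[ℚ] H D, LinearMap.mul' ℚ ℚ (TensorProduct.map (conv f g) h z) =
      LinearMap.mul' ℚ ℚ (TensorProduct.map f (LinearMap.mul' ℚ ℚ ∘ₗ TensorProduct.map g h)
        (TensorProduct.assoc ℚ (H D) (H D) (H D) ((coprod D).rTensor (H D) z))) := by
    intro z
    induction z using TensorProduct.induction_on with
    | zero => simp
    | add a b ha hb => simp only [map_add, ha, hb]
    | tmul a b =>
      simp only [conv, TensorProduct.map_tmul, LinearMap.rTensor_tmul, LinearMap.comp_apply,
        LinearMap.mul'_apply]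
      generalize coprod D a = w
      induction w using TensorProduct.induction_on with
      | zero => simp
      | add a b ha hb => simp only [map_add, add_mul, ha, hb, TensorProduct.add_tmul]
      | tmul a' b' => simp [mul_assoc]
  have h2 : ∀ z : H D ⊗[ℚ] H D, LinearMap.mul' ℚ ℚ (TensorProduct.map f (conv g h) z) =
      LinearMap.mul' ℚ ℚ (TensorProduct.map f (LinearMap.mul' ℚ ℚ ∘ₗ TensorProduct.map g h)
        ((coprod D).lTensor (H D) z)) := by
    intro z
    induction z using TensorProduct.induction_on with
    | zero => simp
    | add a b ha hb => simp only [map_add, ha, hb]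
    | tmul a b => simp [conv]
  refine LinearMap.ext fun x => ?_
  exact (h1 _).trans ((congrArg _ (congrArg _ (coassoc x))).trans (h2 _).symm)

theorem conv_counit (g : H D →ₗ[ℚ] ℚ) : conv (counit D) g = g := by
  have h1 : ∀ z : H D ⊗[ℚ] H D, LinearMap.mul' ℚ ℚ (TensorProduct.map (counit D) g z) =
      g (TensorProduct.lid ℚ (H D) ((counit D).rTensor (H D) z)) := by
    intro z
    induction z using TensorProduct.induction_on with
    | zero => simp
    | add a b ha hb => simp only [map_add, ha, hb]
    | tmul a b => simp
  exact LinearMap.ext fun x => (h1 _).trans (congrArg g (counit_left x))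

theorem conv_counit_right (g : H D →ₗ[ℚ] ℚ) : conv g (counit D) = g := by
  have h1 : ∀ z : H D ⊗[ℚ] H D, LinearMap.mul' ℚ ℚ (TensorProduct.map g (counit D) z) =
      g (TensorProduct.rid ℚ (H D) ((counit D).lTensor (H D) z)) := by
    intro z
    induction z using TensorProduct.induction_on with
    | zero => simp
    | add a b ha hb => simp only [map_add, ha, hb]
    | tmul a b => simp [mul_comm]
  exact LinearMap.ext fun x => (h1 _).trans (congrArg g (counit_right x))

/-- The linear form `(F, ·)`, built by recursion on the forest `F`. -/
noncomputable def psi : PForest D → (H D →ₗ[ℚ] ℚ)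
  | [] => counit D
  | PTree.node d G :: F => conv (psi G ∘ₗ gamma d) (psi F)

theorem psi_append (F G : PForest D) : psi (F ++ G) = conv (psi F) (psi G) := by
  induction F using ind with
  | nil =>
    rw [psi, conv_counit]
    rfl
  | cons d A F _ ih => rw [List.cons_append, psi, psi, ih, conv_assoc]

theorem tmul_apply (B : LinearMap.BilinForm ℚ (H D)) (x₁ x₂ : H D) (z : H D ⊗[ℚ] H D) :
    B.tmul B (x₁ ⊗ₜ[ℚ] x₂) z = LinearMap.mul' ℚ ℚ (TensorProduct.map (B x₁) (B x₂) z) := by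
  induction z using TensorProduct.induction_on with
  | zero => simp
  | add a b ha hb => simp only [map_add, ha, hb]
  | tmul a b => simp [mul_comm]

theorem existsUnique_pairing (D : Type*) : ∃! B : LinearMap.BilinForm ℚ (H D), IsPairing B := by
  refine ⟨linExt psi, ⟨fun y => ?_, fun x₁ x₂ y => ?_, fun d x y => ?_⟩, fun B hB => ?_⟩
  · rw [← mono_nil, linExt_mono, psi]
  · let B : LinearMap.BilinForm ℚ (H D) := linExt psi
    have key : (LinearMap.mul ℚ (H D)).compr₂ (B.flip y) =
        (TensorProduct.mk ℚ (H D) (H D)).compr₂ ((B.tmul B).flip (coprod D y)) := by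
      refine hom_ext fun F => hom_ext fun G => ?_
      simp only [LinearMap.compr₂_apply, LinearMap.mul_apply', LinearMap.BilinForm.flip_apply,
        LinearMap.flip_apply,
        TensorProduct.mk_apply, tmul_apply, B, ← mono_append, linExt_mono, psi_append]
      rfl
    exact LinearMap.congr_fun₂ key x₁ x₂
  · have key : linExt psi ∘ₗ bPlus d = (linExt psi).compl₂ (gamma d) := by
      refine hom_ext fun F => ?_
      simp only [LinearMap.comp_apply, bPlus, linExt_mono, psi, conv_counit_right]
      exact LinearMap.ext fun z => by simp [linExt_mono]
    exact LinearMap.congr_fun₂ key x y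
  · refine hom_ext fun F => ?_
    rw [linExt_mono]
    induction F using ind with
    | nil => exact LinearMap.ext fun y => by rw [mono_nil, hB.one_left, psi]
    | cons d G F hG hF =>
      refine LinearMap.ext fun y => ?_
      have h : B (bPlus d (mono G)) = psi G ∘ₗ gamma d :=
        LinearMap.ext fun z => by rw [hB.bPlus_left, hG, LinearMap.comp_apply]
      rw [mono_cons, hB.mul_left, tmul_apply, h, hF, psi]
      rfl

end Existence

/-- The bilinear form `( , )` on `H`: the unique one with the properties in `IsPairing`. -/
noncomputable def pairing (D : Type*) : LinearMap.BilinForm ℚ (H D) :=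
  (existsUnique_pairing D).choose

theorem isPairing_pairing (D : Type*) : IsPairing (pairing D) :=
  (existsUnique_pairing D).choose_spec.1

/-- The set `I(F, G)` of bijections `f` from the vertices of `F` to those of `G` such that
`x ≥_haut y` implies `f x ≥_gauche f y`, `f x ≥_haut f y` implies `x ≥_gauche y`, and `f` preserves
the decorations. -/
def bijections {D : Type*} (F G : PForest D) : Set (Som F ≃ Som G) :=
  {f | (∀ x y : Som F, x.Haut y → (f x).Gauche (f y)) ∧
    (∀ x y : Som F, (f x).Haut (f y) → x.Gauche y) ∧
    ∀ x : Som F, (f x).deco = x.deco}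

end PForest

namespace PForest

/-! The numbers card I(F, G) obey the same recursion on F as the pairing, so induction on F gives
the equality. Two facts carry this.

Multiplicativity (`ncard_bijections_append`). Let f be in I(AB, G). No vertex of B is ≥_gauche a
vertex of A, so condition 2 prevents the image of a vertex of B from lying above the image of a
vertex of A: f(A) is closed upwards for ≥_haut. Conversely, bijections of A onto an upper set and of
B onto its complement glue without further conditions: vertices of A and B are never
≥_haut-comparable, and every vertex of A is ≥_gauche every vertex of B. Upper sets of G are the sets
above admissible cuts c (`upperSetOfCut_bijective`), and P^c(G), R^c(G) are the upper set and its
complement with the induced relations (`exists_isEmb_pruned`, `exists_isEmb_trunk`). This mirrors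
(x₁x₂, y) = (x₁ ⊗ x₂, Δ(y)).

Trees (`ncard_bijections_tree_snoc`, `bijections_tree_eq_empty`). The root of B_d⁺(F) is below
everything for ≥_haut, so its image is below everything for ≥_gauche. Only a last tree reduced to
one vertex provides such an image, and removing it together with the root gives I(F, γ_d(G)). This
mirrors (B_d⁺(x), y) = (x, γ_d(y)).

Multiplicativity is proved for abstract pairs of relations, because the structures induced on an
upper set and on its complement are not literally vertex sets of forests. -/

/-- Two binary relations `≥_haut`, `≥_gauche` and a decoration on a type. -/
@[ext]
structure Birel (D A : Type*) where
  haut : A → A → Prop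
  gauche : A → A → Prop
  deco : A → D

/-! ### Pairs of relations: ordered sums and gluing of bijections. -/

namespace Birel

variable {D A A' B B' A₁ A₂ : Type*}

/-- The structure induced along a map. -/
def comap (f : A → B) (Y : Birel D B) : Birel D A where
  haut x y := Y.haut (f x) (f y)
  gauche x y := Y.gauche (f x) (f y)
  deco x := Y.deco (f x)

/-- The disjoint union, the first summand lying to the left of the second one. -/
def sum (X₁ : Birel D A₁) (X₂ : Birel D A₂) : Birel D (A₁ ⊕ A₂) where
  haut
    | .inl x, .inl y => X₁.haut x y
    | .inr x, .inr y => X₂.haut x y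
    | _, _ => False
  gauche
    | .inl x, .inl y => X₁.gauche x y
    | .inr x, .inr y => X₂.gauche x y
    | .inl _, .inr _ => True
    | .inr _, .inl _ => False
  deco := Sum.elim X₁.deco X₂.deco

/-- The bijections sending `≥_haut` into `≥_gauche`, whose inverses do so as well, and which
preserve the decorations. -/
def isos (X : Birel D A) (Y : Birel D B) : Set (A ≃ B) :=
  {f | (∀ x y, X.haut x y → Y.gauche (f x) (f y)) ∧
    (∀ x y, Y.haut (f x) (f y) → X.gauche x y) ∧ ∀ x, Y.deco (f x) = X.deco x}

theorem card_isos_comap_right (X : Birel D A) (Y : Birel D B) (e : B' ≃ B) :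
    Nat.card (isos X (Y.comap e)) = Nat.card (isos X Y) :=
  Nat.card_congr ((Equiv.equivCongr (Equiv.refl A) e).subtypeEquiv fun _ => Iff.rfl)

theorem card_isos_comap_left (X : Birel D A) (Y : Birel D B) (e : A' ≃ A) :
    Nat.card (isos (X.comap e) Y) = Nat.card (isos X Y) := by
  refine Nat.card_congr ((Equiv.equivCongr e (Equiv.refl B)).subtypeEquiv fun f => ?_)
  simp [isos, comap, e.forall_congr_left]

/-- The subsets that are closed under passing to larger elements for `≥_haut`. -/
def UpperSets (Y : Birel D B) : Type _ :=
  {S : Set B // ∀ x y, x ∈ S → Y.haut y x → y ∈ S}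

/-- The bijection glued from bijections onto a subset and onto its complement. -/
noncomputable def glue (S : Set B) (f : A₁ ≃ S) (g : A₂ ≃ ↥Sᶜ) : A₁ ⊕ A₂ ≃ B :=
  open Classical in (Equiv.sumCongr f g).trans (Equiv.Set.sumCompl S)

theorem glue_inl (S : Set B) (f : A₁ ≃ S) (g : A₂ ≃ ↥Sᶜ) (x : A₁) :
    glue S f g (.inl x) = f x := rfl

theorem glue_inr (S : Set B) (f : A₁ ≃ S) (g : A₂ ≃ ↥Sᶜ) (x : A₂) :
    glue S f g (.inr x) = g x := rfl

theorem range_glue_inl (S : Set B) (f : A₁ ≃ S) (g : A₂ ≃ ↥Sᶜ) :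
    Set.range (fun x => glue S f g (.inl x)) = S := by
  ext b
  simp only [glue_inl, Set.mem_range]
  exact ⟨fun ⟨x, hx⟩ => hx ▸ (f x).2, fun hb => ⟨f.symm ⟨b, hb⟩, by simp⟩⟩

/-- Mixed pairs impose nothing: `haut` never holds between the two summands, `gauche` always holds
from left to right, and an element of the complement above an element of `S` would belong to `S`. -/
theorem glue_mem_isos (X₁ : Birel D A₁) (X₂ : Birel D A₂) (Y : Birel D B) (S : Y.UpperSets)
    (f : A₁ ≃ S.1) (g : A₂ ≃ ↥S.1ᶜ) :
    glue S.1 f g ∈ isos (X₁.sum X₂) Y ↔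
      f ∈ isos X₁ (Y.comap Subtype.val) ∧ g ∈ isos X₂ (Y.comap Subtype.val) := by
  constructor
  · rintro ⟨h1, h2, h3⟩
    exact ⟨⟨fun x y => h1 (.inl x) (.inl y), fun x y => h2 (.inl x) (.inl y), fun x => h3 (.inl x)⟩,
      ⟨fun x y => h1 (.inr x) (.inr y), fun x y => h2 (.inr x) (.inr y), fun x => h3 (.inr x)⟩⟩
  · rintro ⟨⟨h1, h2, h3⟩, ⟨k1, k2, k3⟩⟩
    refine ⟨?_, ?_, ?_⟩
    · rintro (x | x) (y | y) h
      exacts [h1 x y h, h.elim, h.elim, k1 x y h]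
    · rintro (x | x) (y | y) h
      exacts [h2 x y h, trivial, (g x).2 (S.2 _ _ (f y).2 h), k2 x y h]
    · rintro (x | x)
      exacts [h3 x, k3 x]

/-- Take for `S` the image of the left summand. It is an upper set because the image of a right
element above that of a left one would force `gauche` from right to left, which is false in the sum.
-/
theorem exists_glue (X₁ : Birel D A₁) (X₂ : Birel D A₂) (Y : Birel D B) (F : A₁ ⊕ A₂ ≃ B)
    (hF : F ∈ isos (X₁.sum X₂) Y) :
    ∃ (S : Y.UpperSets) (f : A₁ ≃ S.1) (g : A₂ ≃ ↥S.1ᶜ), glue S.1 f g = F := by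
  have hS : ∀ x y, x ∈ Set.range (fun x => F (.inl x)) → Y.haut y x →
      y ∈ Set.range (fun x => F (.inl x)) := by
    rintro _ y ⟨x, rfl⟩ h
    obtain ⟨z | z, rfl⟩ := F.surjective y
    · exact ⟨z, rfl⟩
    · exact (hF.2.1 (.inr z) (.inl x) h).elim
  let f := Equiv.ofInjective (fun x => F (.inl x)) (F.injective.comp Sum.inl_injective)
  let g₀ : A₂ → ↥(Set.range fun x => F (.inl x))ᶜ := fun x => ⟨F (.inr x), by simp⟩
  have hg : Function.Bijective g₀ := by
    refine ⟨fun x y h => Sum.inr_injective (F.injective (congrArg Subtype.val h)), ?_⟩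
    rintro ⟨b, hb⟩
    obtain ⟨z | z, rfl⟩ := F.surjective b
    · exact (hb ⟨z, rfl⟩).elim
    · exact ⟨z, rfl⟩
  refine ⟨⟨_, hS⟩, f, Equiv.ofBijective g₀ hg, Equiv.ext ?_⟩
  rintro (x | x) <;> rfl

theorem card_isos_sum [Finite A₁] [Finite A₂] [Finite B] (X₁ : Birel D A₁) (X₂ : Birel D A₂)
    (Y : Birel D B) [Fintype Y.UpperSets] :
    Nat.card (isos (X₁.sum X₂) Y) = ∑ S : Y.UpperSets,
      Nat.card (isos X₁ (Y.comap (Subtype.val : S.1 → B))) *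
        Nat.card (isos X₂ (Y.comap (Subtype.val : ↥S.1ᶜ → B))) := by
  simp_rw [← Nat.card_prod]
  rw [← Nat.card_sigma]
  symm
  refine Nat.card_congr (Equiv.ofBijective (fun p => ⟨glue p.1.1 p.2.1.1 p.2.2.1,
    (glue_mem_isos X₁ X₂ Y p.1 _ _).2 ⟨p.2.1.2, p.2.2.2⟩⟩) ⟨?_, ?_⟩)
  · rintro ⟨S, ⟨f, hf⟩, ⟨g, hg⟩⟩ ⟨T, ⟨f', hf'⟩, ⟨g', hg'⟩⟩ h
    have h0 : glue S.1 f g = glue T.1 f' g' := congrArg Subtype.val h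
    -- The upper set is recovered from the glued map as the image of the left summand.
    have hST : S = T := Subtype.ext (by rw [← range_glue_inl S.1 f g, h0, range_glue_inl])
    subst hST
    have h1 : f = f' := Equiv.ext fun x => Subtype.ext (Equiv.congr_fun h0 (.inl x))
    have h2 : g = g' := Equiv.ext fun x => Subtype.ext (Equiv.congr_fun h0 (.inr x))
    subst h1 h2
    rfl
  · rintro ⟨F, hF⟩
    obtain ⟨S, f, g, rfl⟩ := exists_glue X₁ X₂ Y F hF
    obtain ⟨hf, hg⟩ := (glue_mem_isos X₁ X₂ Y S f g).1 hF
    exact ⟨⟨S, ⟨f, hf⟩, ⟨g, hg⟩⟩, rfl⟩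

end Birel

/-! ### The relations on the vertices of a concatenation. -/

section Vertices

variable {D : Type*}

/-- The relations `≥_haut`, `≥_gauche` and the decoration on the vertices of a forest. -/
def birel (F : PForest D) : Birel D (Som F) := ⟨Som.Haut, Som.Gauche, Som.deco⟩

theorem ncard_bijections (F G : PForest D) :
    (bijections F G).ncard = Nat.card (Birel.isos (birel F) (birel G)) := rfl

section ConsHaut

variable {d : D} {G F : PForest D}

@[simp]
theorem haut_refl (x : Som F) : x.Haut x := .refl

@[simp]
theorem haut_root_child (x : Som G) :
    ¬ Som.Haut (Som.root : Som (PTree.node d G :: F)) (Som.child x) := by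
  intro h
  rcases Relation.ReflTransGen.cases_tail h with h | ⟨b, -, h⟩
  · cases h
  · cases b <;> simp [Som.Edge] at h

@[simp]
theorem haut_root_tail (x : Som F) :
    ¬ Som.Haut (Som.root : Som (PTree.node d G :: F)) (Som.tail x) :=
  not_haut_of_tail x _ (by simp)

@[simp]
theorem haut_child_root (x : Som G) :
    Som.Haut (Som.child x : Som (PTree.node d G :: F)) Som.root :=
  haut_root x

@[simp]
theorem haut_child_child (x y : Som G) :
    Som.Haut (Som.child x : Som (PTree.node d G :: F)) (Som.child y) ↔ Som.Haut x y :=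
  haut_child_iff

@[simp]
theorem haut_child_tail (x : Som G) (y : Som F) :
    ¬ Som.Haut (Som.child x : Som (PTree.node d G :: F)) (Som.tail y) :=
  not_haut_of_tail y _ (by simp)

@[simp]
theorem haut_tail_root (x : Som F) :
    ¬ Som.Haut (Som.tail x : Som (PTree.node d G :: F)) Som.root :=
  not_haut_tail x _ (by simp)

@[simp]
theorem haut_tail_child (x : Som F) (y : Som G) :
    ¬ Som.Haut (Som.tail x : Som (PTree.node d G :: F)) (Som.child y) :=
  not_haut_tail x _ (by simp)

@[simp]
theorem haut_tail_tail (x y : Som F) :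
    Som.Haut (Som.tail x : Som (PTree.node d G :: F)) (Som.tail y) ↔ Som.Haut x y :=
  haut_tail_iff

end ConsHaut

/-- Makes `≥_haut` a partial order, so that upper sets can be described by their minimal elements.
-/
theorem haut_antisymm {F : PForest D} (x y : Som F) (h : x.Haut y) (h' : y.Haut x) : x = y := by
  induction x with
  | root => cases y <;> simp_all
  | child x ih =>
    cases y <;> simp_all
    exact ih _ h h'
  | tail x ih =>
    cases y <;> simp_all
    exact ih _ h h'

/-- The vertices of the left factor of a concatenation. -/
def Som.appendLeft (G : PForest D) : {F : PForest D} → Som F → Som (F ++ G)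
  | PTree.node _ _ :: _, .root => .root
  | PTree.node _ _ :: _, .child x => .child x
  | PTree.node _ _ :: _, .tail x => .tail (appendLeft G x)

/-- The vertices of the right factor of a concatenation. -/
def Som.appendRight {G : PForest D} : (F : PForest D) → Som G → Som (F ++ G)
  | [], x => x
  | PTree.node _ _ :: F, x => .tail (appendRight F x)

theorem elim_append_bijective (F G : PForest D) :
    Function.Bijective (Sum.elim (Som.appendLeft G) (Som.appendRight F) : Som F ⊕ Som G → _) := by
  induction F using ind with
  | nil =>
    refine ⟨?_, fun x => ⟨.inr x, rfl⟩⟩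
    rintro (x | x) (y | y) h
    exacts [(nomatch x), (nomatch x), (nomatch y), congrArg Sum.inr h]
  | cons d K F _ ih =>
    constructor
    · rintro (x | x) (y | y) h
      · cases x <;> cases y <;> simp [Som.appendLeft] at h ⊢
        · exact h
        · exact Sum.inl_injective (ih.1 (a₁ := .inl _) (a₂ := .inl _) h)
      · cases x <;> simp [Som.appendLeft, Som.appendRight] at h
        exact absurd (ih.1 (a₁ := .inl _) (a₂ := .inr _) h) (by simp)
      · cases y <;> simp [Som.appendLeft, Som.appendRight] at h
        exact absurd (ih.1 (a₁ := .inr _) (a₂ := .inl _) h) (by simp)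
      · have h := Som.tail.inj (d := d) (G := K) h
        exact congrArg Sum.inr (Sum.inr_injective (ih.1 (a₁ := .inr _) (a₂ := .inr _) h))
    · intro x
      cases x with
      | root => exact ⟨.inl .root, rfl⟩
      | child x => exact ⟨.inl (.child x), rfl⟩
      | tail x =>
        obtain ⟨y | y, rfl⟩ := ih.2 x
        · exact ⟨.inl (.tail y), rfl⟩
        · exact ⟨.inr y, rfl⟩

/-- The vertices of a concatenation of two forests. -/
noncomputable def appendEquiv (F G : PForest D) : Som F ⊕ Som G ≃ Som (F ++ G) :=
  Equiv.ofBijective _ (elim_append_bijective F G)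

/-- Brings products of forests within reach of the abstract gluing: concatenation is the ordered sum
`Birel.sum`. -/
theorem birel_append (F G : PForest D) :
    (birel (F ++ G)).comap (appendEquiv F G) = (birel F).sum (birel G) := by
  have key : (∀ x y : Som F ⊕ Som G, (appendEquiv F G x).Haut (appendEquiv F G y) ↔
      ((birel F).sum (birel G)).haut x y) ∧
      (∀ x y : Som F ⊕ Som G, (appendEquiv F G x).Gauche (appendEquiv F G y) ↔
      ((birel F).sum (birel G)).gauche x y) ∧
      ∀ x : Som F ⊕ Som G, (appendEquiv F G x).deco = ((birel F).sum (birel G)).deco x := by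
    induction F using ind with
    | nil =>
      refine ⟨?_, ?_, ?_⟩
      · rintro (x | x) (y | y)
        exacts [(nomatch x), (nomatch x), (nomatch y), Iff.rfl]
      · rintro (x | x) (y | y)
        exacts [(nomatch x), (nomatch x), (nomatch y), Iff.rfl]
      · rintro (x | x)
        exacts [(nomatch x), rfl]
    | cons d K F _ ih =>
      have e1 : appendEquiv (PTree.node d K :: F) G (.inl .root) = Som.root := rfl
      have e2 : ∀ x, appendEquiv (PTree.node d K :: F) G (.inl (.child x)) = Som.child x :=
        fun _ => rfl
      have e3 : ∀ x, appendEquiv (PTree.node d K :: F) G (.inl (.tail x)) =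
        Som.tail (appendEquiv F G (.inl x)) := fun _ => rfl
      have e4 : ∀ x, appendEquiv (PTree.node d K :: F) G (.inr x) =
        Som.tail (appendEquiv F G (.inr x)) := fun _ => rfl
      obtain ⟨ih1, ih2, ih3⟩ := ih
      refine ⟨?_, ?_, ?_⟩
      · rintro ((_ | x | x) | x) ((_ | y | y) | y) <;>
          simp only [e1, e2, e3, e4, haut_refl, haut_root_child, haut_root_tail, haut_child_root, haut_child_child,
            haut_child_tail, haut_tail_root, haut_tail_child, haut_tail_tail, ih1] <;>
          simp [birel, Birel.sum]
      · rintro ((_ | x | x) | x) ((_ | y | y) | y) <;>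
          simp only [e1, e2, e3, e4, Som.Gauche, ih2] <;>
          simp [birel, Birel.sum, Som.Gauche]
      · rintro ((_ | x | x) | x) <;>
          simp only [e1, e2, e3, e4, Som.deco, ih3] <;>
          simp [birel, Birel.sum, Som.deco]
  exact Birel.ext (funext₂ fun x y => propext (key.1 x y)) (funext₂ fun x y => propext (key.2.1 x y))
    (funext key.2.2)

end Vertices
end PForest
namespace PForest

/-! ### Admissible cuts as upper sets, and multiplicativity. -/

section Cuts

variable {D : Type*}

instance isEmpty_som_nil : IsEmpty (Som ([] : PForest D)) := ⟨fun x => nomatch x⟩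

/-- An injection on vertices that preserves and reflects `≥_haut`, `≥_gauche` and the
decorations. -/
structure IsEmb {F G : PForest D} (f : Som F → Som G) : Prop where
  inj : Function.Injective f
  comap_eq : (birel G).comap f = birel F

/-- The map from the vertices of the tree `B_d⁺(A)` to those of `B_d⁺(G) F` extending a map from the
vertices of `A` to those of `G`. -/
def mapTree {A G : PForest D} (f : Som A → Som G) (d : D) (F : PForest D) :
    Som [PTree.node d A] → Som (PTree.node d G :: F)
  | .root => .root
  | .child x => .child (f x)
  | .tail x => nomatch x

theorem IsEmb.mapTree {A G : PForest D} {f : Som A → Som G} (hf : IsEmb f) (d : D)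
    (F : PForest D) : IsEmb (mapTree f d F) := by
  have h1 : ∀ x y, Som.Haut (f x) (f y) ↔ Som.Haut x y := fun x y =>
    iff_of_eq (congrFun₂ (congrArg Birel.haut hf.comap_eq) x y)
  have h2 : ∀ x y, Som.Gauche (f x) (f y) ↔ Som.Gauche x y := fun x y =>
    iff_of_eq (congrFun₂ (congrArg Birel.gauche hf.comap_eq) x y)
  have h3 : ∀ x, Som.deco (f x) = Som.deco x := fun x =>
    congrFun (congrArg Birel.deco hf.comap_eq) x
  refine ⟨?_, Birel.ext (funext₂ fun x y => ?_) (funext₂ fun x y => ?_) (funext fun x => ?_)⟩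
  · rintro (_ | x | x) (_ | y | y) h <;> simp [PForest.mapTree] at h ⊢
    all_goals first | exact hf.inj h | exact isEmptyElim x | exact isEmptyElim y
  · rcases x with _ | x | x <;> rcases y with _ | y | y <;>
      first | exact isEmptyElim x | exact isEmptyElim y | simp [PForest.mapTree, Birel.comap, birel, h1]
  · rcases x with _ | x | x <;> rcases y with _ | y | y <;>
      first
      | exact isEmptyElim x
      | exact isEmptyElim y
      | simp [PForest.mapTree, Birel.comap, birel, Som.Gauche, h2]
  · rcases x with _ | x | x <;>
      first | exact isEmptyElim x | simp [PForest.mapTree, Birel.comap, birel, Som.deco, h3]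

theorem isEmb_id (F : PForest D) : IsEmb (id : Som F → Som F) := ⟨fun _ _ h => h, rfl⟩

theorem IsEmb.child {A G : PForest D} {f : Som A → Som G} (hf : IsEmb f) (d : D) (F : PForest D) :
    IsEmb (fun x => (Som.child (f x) : Som (PTree.node d G :: F))) := by
  refine ⟨fun x y h => hf.inj (by simpa using h), ?_⟩
  rw [← hf.comap_eq]
  simp [Birel.comap, birel, Som.Gauche, Som.deco]

/-- The inductive step for `pruned` and `trunk`, which concatenate a piece of the first tree with a
piece of the remaining forest. Hypothesis `h` confines the image of `f` to the first tree, hence to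
the left of the image of `g` and `≥_haut`-incomparable to it, exactly as in an ordered sum. -/
theorem IsEmb.append {d : D} {A B G F : PForest D} {f : Som A → Som (PTree.node d G :: F)}
    {g : Som B → Som F} (hf : IsEmb f) (hg : IsEmb g) (h : ∀ x z, f x ≠ Som.tail z) :
    ∃ k : Som (A ++ B) → Som (PTree.node d G :: F), IsEmb k ∧
      Set.range k = Set.range f ∪ Set.range fun x => Som.tail (g x) := by
  let s : Som A ⊕ Som B → Som (PTree.node d G :: F) := Sum.elim f fun x => .tail (g x)
  have hs : (birel (PTree.node d G :: F)).comap s = (birel A).sum (birel B) := by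
    rw [← hf.comap_eq, ← hg.comap_eq]
    refine Birel.ext (funext₂ ?_) (funext₂ ?_) (funext ?_)
    · rintro (x | x) (y | y)
      · rfl
      · exact eq_false (not_haut_of_tail _ _ (h x))
      · exact eq_false (not_haut_tail _ _ (h y))
      · simp [s, Birel.comap, birel, Birel.sum]
    · rintro (x | x) (y | y)
      · rfl
      · have := h x
        rcases hx : f x with _ | z | z <;>
          simp_all [s, Birel.comap, birel, Birel.sum, Som.Gauche]
      · have := h y
        rcases hx : f y with _ | z | z <;>
          simp_all [s, Birel.comap, birel, Birel.sum, Som.Gauche]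
      · simp [s, Birel.comap, birel, Birel.sum, Som.Gauche]
    · rintro (x | x) <;> simp [s, Birel.comap, birel, Birel.sum, Som.deco]
  have hinj : Function.Injective s := by
    rintro (x | x) (y | y) hxy
    · exact congrArg _ (hf.inj hxy)
    · exact (h x _ hxy).elim
    · exact (h y _ hxy.symm).elim
    · exact congrArg _ (hg.inj (Som.tail.inj hxy))
  refine ⟨s ∘ (appendEquiv A B).symm, ⟨hinj.comp (Equiv.injective _), ?_⟩, ?_⟩
  · rw [← birel_append] at hs
    exact (congrArg (Birel.comap (appendEquiv A B).symm) hs).trans (by simp [Birel.comap])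
  · rw [EquivLike.range_comp, Set.Sum.elim_range]

/-- The vertices lying above an element of a cut. -/
def above {F : PForest D} (c : Set (Som F)) : Set (Som F) := {x | ∃ y ∈ c, x.Haut y}

section Above

variable {d : D} {G F : PForest D} (c : Set (Som (PTree.node d G :: F)))

theorem root_mem_above : Som.root ∈ above c ↔ Som.root ∈ c := by
  constructor
  · rintro ⟨_ | y | y, hy, h⟩ <;> simp_all
  · exact fun h => ⟨_, h, .refl⟩

theorem child_mem_above (x : Som G) :
    Som.child x ∈ above c ↔ Som.root ∈ c ∨ x ∈ above {x | Som.child x ∈ c} := by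
  constructor
  · rintro ⟨_ | y | y, hy, h⟩
    · exact .inl hy
    · exact .inr ⟨y, hy, by simpa using h⟩
    · simp at h
  · rintro (h | ⟨y, hy, h⟩)
    · exact ⟨_, h, by simp⟩
    · exact ⟨_, hy, by simpa using h⟩

theorem tail_mem_above (x : Som F) :
    Som.tail x ∈ above c ↔ x ∈ above {x | Som.tail x ∈ c} := by
  constructor
  · rintro ⟨_ | y | y, hy, h⟩
    · simp at h
    · simp at h
    · exact ⟨y, hy, by simpa using h⟩
  · rintro ⟨y, hy, h⟩
    exact ⟨_, hy, by simpa using h⟩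

end Above

/-- The pruned forest is the part of `F` above the cut, with the induced relations. The antichain
condition plays no role here: `pruned` ignores whatever `c` contains above a vertex already cut, and
so does `above`. -/
theorem exists_isEmb_pruned (F : PForest D) (c : Set (Som F)) :
    ∃ f : Som (pruned F c) → Som F, IsEmb f ∧ Set.range f = above c := by
  induction F using ind with
  | nil =>
    have e : pruned [] c = [] := by simp [pruned]
    rw [e]
    exact ⟨id, isEmb_id _, Set.ext fun x => nomatch x⟩
  | cons d G F hG hF =>
    obtain ⟨g, hg, hgr⟩ := hF {x | Som.tail x ∈ c}
    obtain ⟨f, hf, hfr⟩ := hG {x | Som.child x ∈ c}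
    by_cases hr : Som.root ∈ c
    -- Total cut of the first tree: the whole tree is pruned and embeds identically.
    · obtain ⟨k, hk, hkr⟩ := ((isEmb_id G).mapTree d F).append hg (by
        rintro (_ | x | x) z
        · simp [mapTree]
        · simp [mapTree]
        · exact (nomatch x))
      have e : pruned (PTree.node d G :: F) c = [PTree.node d G] ++ pruned F {x | Som.tail x ∈ c} := by
        simp [pruned, hr]
      rw [e]
      refine ⟨k, hk, hkr.trans (Set.ext ?_)⟩
      rintro (_ | x | x)
      · simpa [root_mem_above, hr] using ⟨.root, rfl⟩
      · simpa [child_mem_above, hr] using ⟨.child x, rfl⟩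
      · rw [tail_mem_above, ← hgr]
        simp only [Set.mem_union, Set.mem_range, Som.tail.injEq, or_iff_right_iff_imp]
        rintro ⟨_ | y | y, hy⟩
        · cases hy
        · cases hy
        · exact (nomatch y)
    -- The root stays in the trunk, so the pruned vertices of the first tree are proper descendants
    -- of its root.
    · obtain ⟨k, hk, hkr⟩ := (hf.child d F).append hg (by simp)
      have e : pruned (PTree.node d G :: F) c =
          pruned G {x | Som.child x ∈ c} ++ pruned F {x | Som.tail x ∈ c} := by
        simp [pruned, hr]
      rw [e]
      refine ⟨k, hk, hkr.trans (Set.ext ?_)⟩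
      rintro (_ | x | x)
      · simp [root_mem_above, hr]
      · simp [child_mem_above, hr, ← hfr]
      · simp [tail_mem_above, ← hgr]

/-- Complementary to the pruned case: a total cut removes the whole first tree, and otherwise its
root survives below the trunk of its branches. -/
theorem exists_isEmb_trunk (F : PForest D) (c : Set (Som F)) :
    ∃ f : Som (trunk F c) → Som F, IsEmb f ∧ Set.range f = (above c)ᶜ := by
  induction F using ind with
  | nil =>
    have e : trunk [] c = [] := by simp [trunk]
    rw [e]
    exact ⟨id, isEmb_id _, Set.ext fun x => nomatch x⟩
  | cons d G F hG hF =>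
    obtain ⟨g, hg, hgr⟩ := hF {x | Som.tail x ∈ c}
    obtain ⟨f, hf, hfr⟩ := hG {x | Som.child x ∈ c}
    by_cases hr : Som.root ∈ c
    · have e : trunk (PTree.node d G :: F) c = trunk F {x | Som.tail x ∈ c} := by
        simp [trunk, hr]
      rw [e]
      refine ⟨fun x => .tail (g x), ⟨fun x y h => hg.inj (by simpa using h), ?_⟩, Set.ext ?_⟩
      · rw [← hg.comap_eq]
        simp [Birel.comap, birel, Som.Gauche, Som.deco]
      · rintro (_ | x | x)
        · simp [root_mem_above, hr]
        · simp [child_mem_above, hr]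
        · rw [Set.mem_compl_iff, tail_mem_above, ← Set.mem_compl_iff, ← hgr]
          simp
    · obtain ⟨k, hk, hkr⟩ := (hf.mapTree d F).append hg (by
        rintro (_ | x | x) z
        · simp [mapTree]
        · simp [mapTree]
        · exact (nomatch x))
      have e : trunk (PTree.node d G :: F) c =
          [PTree.node d (trunk G {x | Som.child x ∈ c})] ++ trunk F {x | Som.tail x ∈ c} := by
        simp [trunk, hr]
      rw [e]
      refine ⟨k, hk, hkr.trans (Set.ext ?_)⟩
      rintro (_ | x | x)
      · simpa [root_mem_above, hr] using ⟨.root, rfl⟩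
      · rw [Set.mem_compl_iff, child_mem_above, or_iff_right hr, ← Set.mem_compl_iff, ← hfr]
        simp only [Set.mem_union, Set.mem_range, reduceCtorEq, exists_false, or_false]
        constructor
        · rintro ⟨_ | y | y, hy⟩
          · cases hy
          · exact ⟨y, Som.child.inj hy⟩
          · exact (nomatch y)
        · rintro ⟨y, rfl⟩
          exact ⟨.child y, rfl⟩
      · rw [Set.mem_compl_iff, tail_mem_above, ← Set.mem_compl_iff, ← hgr]
        simp only [Set.mem_union, Set.mem_range, Som.tail.injEq, or_iff_right_iff_imp]
        rintro ⟨_ | y | y, hy⟩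
        · cases hy
        · cases hy
        · exact (nomatch y)

theorem card_isos_of_isEmb {A : Type*} (X : Birel D A) {F G : PForest D} {f : Som F → Som G}
    (hf : IsEmb f) {S : Set (Som G)} (hS : Set.range f = S) :
    Nat.card (Birel.isos X (birel F)) =
      Nat.card (Birel.isos X ((birel G).comap (Subtype.val : S → Som G))) := by
  subst hS
  rw [← hf.comap_eq, ← Birel.card_isos_comap_right _ _ (Equiv.ofInjective f hf.inj)]
  rfl

/-- A cut corresponds to the set of vertices lying above it. -/
def upperSetOfCut (F : PForest D) (c : AdmissibleCut F) : (birel F).UpperSets :=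
  ⟨above c.1, fun _ _ ⟨z, hz, hx⟩ hy => ⟨z, hz, hx.trans hy⟩⟩

/-- An upper set of a finite poset is generated by its minimal elements, and an antichain is the set
of minimal elements of the upper set it generates. -/
theorem upperSetOfCut_bijective (F : PForest D) : Function.Bijective (upperSetOfCut F) := by
  constructor
  · have key : ∀ c c' : AdmissibleCut F, above c.1 = above c'.1 → c.1 ⊆ c'.1 := by
      intro c c' h x hx
      -- This gives `x` above `y` in `c'` and `y` above `z` in `c`. The antichain `c` forces `x =
      -- z`, and antisymmetry then gives `x = y`.
      obtain ⟨y, hy, hxy⟩ : x ∈ above c'.1 := h ▸ ⟨x, hx, .refl⟩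
      obtain ⟨z, hz, hyz⟩ : y ∈ above c.1 := h ▸ ⟨y, hy, .refl⟩
      have hzx : x = z := by
        by_contra hne
        exact c.2 hx hz hne (hyz.trans hxy)
      subst hzx
      exact haut_antisymm _ _ hxy hyz ▸ hy
    intro c c' h
    have h := congrArg Subtype.val h
    exact Subtype.ext ((key c c' h).antisymm (key c' c h.symm))
  · rintro ⟨S, hS⟩
    -- Roots are the small elements, so the minimal elements of `S` are the places to cut.
    let _ : PartialOrder (Som F) :=
      { le := fun x y => y.Haut x
        le_refl := fun _ => .refl
        le_trans := fun _ _ _ h h' => h.trans h'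
        le_antisymm := fun _ _ h h' => haut_antisymm _ _ h' h }
    refine ⟨⟨{x | Minimal (· ∈ S) x}, fun x hx y hy hne h => ?_⟩, Subtype.ext (Set.ext fun x => ?_)⟩
    · exact hne ((hx.eq_of_le hy.1 h).symm)
    · constructor
      · rintro ⟨y, hy, h⟩
        exact hS y x hy.1 h
      · intro hx
        obtain ⟨m, hm, hmin⟩ := S.toFinite.exists_le_minimal hx
        exact ⟨m, hmin, hm⟩

/-- The counterpart for `bijections` of the coproduct formula for the pairing: the cut is read off
from the upper set covered by the vertices of `A`. -/
theorem ncard_bijections_append (A B G : PForest D) :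
    (bijections (A ++ B) G).ncard = ∑ c : AdmissibleCut G,
      (bijections A (pruned G c.1)).ncard * (bijections B (trunk G c.1)).ncard := by
  have : Finite (birel G).UpperSets := Subtype.finite
  have : Fintype (birel G).UpperSets := Fintype.ofFinite _
  rw [ncard_bijections, ← Birel.card_isos_comap_left _ _ (appendEquiv A B), birel_append,
    Birel.card_isos_sum, ← (Equiv.ofBijective _ (upperSetOfCut_bijective G)).sum_comp]
  refine Finset.sum_congr rfl fun c _ => ?_
  obtain ⟨f, hf, hfr⟩ := exists_isEmb_pruned G c.1
  obtain ⟨g, hg, hgr⟩ := exists_isEmb_trunk G c.1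
  rw [ncard_bijections, ncard_bijections, card_isos_of_isEmb _ hf hfr, card_isos_of_isEmb _ hg hgr]
  rfl

end Cuts

/-! ### Bijections from a single tree, and the operator γ_d. -/

section Tree

variable {D : Type*}

theorem optionCongr_removeNone {α β : Type*} (e : Option α ≃ Option β) (h : e none = none) :
    Equiv.optionCongr (Equiv.removeNone e) = e := by
  refine Equiv.ext ?_
  rintro (_ | x)
  · exact h.symm
  · refine Equiv.removeNone_some e (Option.ne_none_iff_exists'.1 fun hx => ?_)
    exact absurd (e.injective (hx.trans h.symm)) (by simp)

/-- The vertices of `B_d⁺(F)` are those of `F` and the root. -/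
def treeEquiv (d : D) (F : PForest D) : Option (Som F) ≃ Som [PTree.node d F] where
  toFun o := o.elim .root .child
  invFun
    | .root => none
    | .child x => some x
    | .tail x => nomatch x
  left_inv o := by cases o <;> rfl
  right_inv x := by
    rcases x with _ | x | x
    exacts [rfl, rfl, (nomatch x)]

/-- The vertices of `G •_d` are those of `G` and one more. -/
noncomputable def snocEquiv (d : D) (G : PForest D) : Option (Som G) ≃ Som (G ++ [PTree.node d []]) :=
  have : Unique (Som [PTree.node d []]) :=
    ⟨⟨.root⟩, by rintro (_ | x | x); exacts [rfl, (nomatch x), (nomatch x)]⟩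
  ((Equiv.optionEquivSumPUnit.{0} (Som G)).trans
    (Equiv.sumCongr (Equiv.refl _) (Equiv.ofUnique _ _))).trans (appendEquiv G [PTree.node d []])

/-- A vertex outside the last tree is not below the root of the last tree for `≥_gauche`. Inside the
last tree, the root is incomparable to every other vertex, so the root is the only candidate and
must be alone. -/
theorem eq_nil_of_forall_gauche {G K : PForest D} {d : D} (v : Som (G ++ [PTree.node d K]))
    (hv : ∀ y, Som.Gauche y v) : K = [] ∧ v = Som.appendRight G .root := by
  have hg : ∀ s t, (appendEquiv G [PTree.node d K] s).Gauche (appendEquiv G [PTree.node d K] t) ↔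
      ((birel G).sum (birel [PTree.node d K])).gauche s t := fun s t =>
    iff_of_eq (congrFun₂ (congrArg Birel.gauche (birel_append G [PTree.node d K])) s t)
  obtain ⟨s, rfl⟩ := (appendEquiv G [PTree.node d K]).surjective v
  replace hv := fun t => (hg t s).1 (hv _)
  rcases s with s | (_ | s | s)
  · exact (hv (.inr .root)).elim
  · refine ⟨?_, rfl⟩
    rcases K with _ | ⟨⟨d', L⟩, K⟩
    · rfl
    · have h : Som.Gauche (.child .root) .root := hv (.inr (.child .root))
      simp [Som.Gauche] at h
  · have h : Som.Gauche .root (.child s) := hv (.inr .root)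
    simp [Som.Gauche] at h
  · exact (nomatch s)

theorem map_root_gauche {d : D} {F G : PForest D} {f : Som [PTree.node d F] ≃ Som G}
    (hf : f ∈ bijections [PTree.node d F] G) (y : Som G) : y.Gauche (f .root) := by
  obtain ⟨x, rfl⟩ := f.surjective y
  refine hf.1 _ _ ?_
  rcases x with _ | x | x
  exacts [.refl, haut_root x, (nomatch x)]

/-- The root and the added last vertex must correspond to each other, and deleting both loses no
information. -/
theorem ncard_bijections_tree_snoc (d : D) (F G : PForest D) :
    (bijections [PTree.node d F] (G ++ [PTree.node d []])).ncard = (bijections F G).ncard := by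
  have hs : ∀ o : Option (Som G), snocEquiv d G o =
      appendEquiv G [PTree.node d []] (o.elim (.inr .root) .inl) := by
    rintro (_ | x) <;> rfl
  have hh : ∀ s t : Option (Som G), (snocEquiv d G s).Haut (snocEquiv d G t) ↔
      ((birel G).sum (birel [PTree.node d []])).haut
        (s.elim (.inr .root) .inl) (t.elim (.inr .root) .inl) := fun s t => by
    rw [hs, hs]
    exact iff_of_eq (congrFun₂ (congrArg Birel.haut (birel_append G [PTree.node d []])) _ _)
  have hg : ∀ s t : Option (Som G), (snocEquiv d G s).Gauche (snocEquiv d G t) ↔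
      ((birel G).sum (birel [PTree.node d []])).gauche
        (s.elim (.inr .root) .inl) (t.elim (.inr .root) .inl) := fun s t => by
    rw [hs, hs]
    exact iff_of_eq (congrFun₂ (congrArg Birel.gauche (birel_append G [PTree.node d []])) _ _)
  have hd : ∀ s : Option (Som G), (snocEquiv d G s).deco =
      ((birel G).sum (birel [PTree.node d []])).deco (s.elim (.inr .root) .inl) := fun s => by
    rw [hs]
    exact congrFun (congrArg Birel.deco (birel_append G [PTree.node d []])) _
  let φ : (Som F ≃ Som G) → (Som [PTree.node d F] ≃ Som (G ++ [PTree.node d []])) := fun f =>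
    Equiv.equivCongr (treeEquiv d F) (snocEquiv d G) (Equiv.optionCongr f)
  have hφr : ∀ f, φ f .root = snocEquiv d G none := fun f => rfl
  have hφc : ∀ f x, φ f (.child x) = snocEquiv d G (some (f x)) := fun f x => rfl
  have hmem : ∀ f, φ f ∈ bijections [PTree.node d F] (G ++ [PTree.node d []]) ↔
      f ∈ bijections F G := by
    intro f
    constructor
    · rintro ⟨h1, h2, h3⟩
      refine ⟨fun x y h => ?_, fun x y h => ?_, fun x => ?_⟩
      · exact (hg (some _) (some _)).1 (h1 (.child x) (.child y) (by simpa using h))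
      · have := h2 (.child x) (.child y) ((hh (some _) (some _)).2 h)
        simpa [Som.Gauche] using this
      · exact (hd (some _)).symm.trans (h3 (.child x))
    -- Pairs with exactly one root: condition 1 holds because the added vertex is to the right of
    -- all of `G`; condition 2 is vacuous because that vertex is `≥_haut`-incomparable to those of
    -- `G`.
    · rintro ⟨h1, h2, h3⟩
      refine ⟨?_, ?_, ?_⟩
      · rintro (_ | x | x) (_ | y | y) h
        · rw [hφr, hg]; trivial
        · simp at h
        · exact (nomatch y)
        · rw [hφc, hφr, hg]; trivial
        · rw [hφc, hφc, hg]
          exact h1 x y (by simpa using h)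
        · exact (nomatch y)
        · exact (nomatch x)
        · exact (nomatch x)
        · exact (nomatch x)
      · rintro (_ | x | x) (_ | y | y) h
        · simp [Som.Gauche]
        · rw [hφc, hφr, hh] at h
          exact h.elim
        · exact (nomatch y)
        · rw [hφc, hφr, hh] at h
          exact h.elim
        · rw [hφc, hφc, hh] at h
          simpa [Som.Gauche] using h2 x y h
        · exact (nomatch y)
        · exact (nomatch x)
        · exact (nomatch x)
        · exact (nomatch x)
      · rintro (_ | x | x)
        · rw [hφr, hd]; rfl
        · rw [hφc, hd]; exact h3 x
        · exact (nomatch x)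
  symm
  refine Set.ncard_congr (fun f _ => φ f) (fun f hf => (hmem f).2 hf) (fun f g _ _ h => ?_)
    fun k hk => ?_
  · exact Equiv.optionCongr_injective ((Equiv.equivCongr _ _).injective h)
  -- Surjectivity of `φ`: every admissible `k` sends the root to the added vertex, so in `Option`
  -- coordinates it fixes `none` and comes from a bijection of the remaining vertices.
  · have hroot : k .root = snocEquiv d G none :=
      (eq_nil_of_forall_gauche _ (map_root_gauche hk)).2
    obtain ⟨o, rfl⟩ := (Equiv.equivCongr (treeEquiv d F) (snocEquiv d G)).surjective k
    have hk' : φ (Equiv.removeNone o) = Equiv.equivCongr (treeEquiv d F) (snocEquiv d G) o :=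
      congrArg (Equiv.equivCongr (treeEquiv d F) (snocEquiv d G))
        (optionCongr_removeNone o ((snocEquiv d G).injective hroot))
    exact ⟨_, (hmem _).1 (hk'.symm ▸ hk), hk'⟩

/-- The image of the root would be the single vertex of the last tree, and preservation of
decorations would give it the decoration `d`. -/
theorem bijections_tree_eq_empty (d : D) (F G : PForest D)
    (hG : G.getLast? ≠ some (PTree.node d [])) : bijections [PTree.node d F] G = ∅ := by
  refine Set.eq_empty_of_forall_notMem fun f hf => ?_
  obtain rfl | ⟨G, ⟨d', K⟩, rfl⟩ := List.eq_nil_or_concat' G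
  · exact nomatch f .root
  · obtain ⟨rfl, hv⟩ := eq_nil_of_forall_gauche _ (map_root_gauche hf)
    have h1 : (f .root).deco = d := hf.2.2 .root
    have h2 : (Som.appendRight G (.root : Som [PTree.node d' []])).deco = d' :=
      congrFun (congrArg Birel.deco (birel_append G [PTree.node d' []])) (.inr .root)
    rw [hv, h2] at h1
    simp [h1] at hG

theorem ncard_bijections_nil (G : PForest D) [Decidable (G = [])] :
    (bijections [] G).ncard = if G = [] then 1 else 0 := by
  split_ifs with h
  · subst h
    rw [Set.ncard_eq_one]
    exact ⟨Equiv.refl _, Set.eq_singleton_iff_unique_mem.2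
      ⟨⟨isEmptyElim, isEmptyElim, isEmptyElim⟩, fun f _ => Equiv.ext isEmptyElim⟩⟩
  · rcases G with _ | ⟨⟨d, K⟩, G⟩
    · exact (h rfl).elim
    · rw [Set.eq_empty_of_forall_notMem (s := bijections [] _) (fun f _ => isEmptyElim (f.symm .root)),
        Set.ncard_empty]

theorem pairing_cons (d : D) (A F G : PForest D) :
    pairing D (mono (PTree.node d A :: F)) (mono G) = ∑ c : AdmissibleCut G,
      pairing D (mono A) (gamma d (mono (pruned G c.1))) * pairing D (mono F) (mono (trunk G c.1)) := by
  rw [mono_cons, (isPairing_pairing D).mul_left, tmul_apply, coprod, linExt_mono, map_sum, map_sum]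
  simp [(isPairing_pairing D).bPlus_left]

end Tree

end PForest

/-! ### Comparison of the two recursions. -/

open PForest in
theorem mainTheorem6 {D : Type*} (F G : PForest D) :
    PForest.pairing D (PForest.mono F) (PForest.mono G) = ((PForest.bijections F G).ncard : ℚ) := by
  -- `G` must vary: the hypotheses are applied to the trunk of `G` and to its pruned part without
  -- the last tree.
  induction F using ind generalizing G with
  | nil =>
    classical
    rw [mono_nil, (isPairing_pairing D).one_left, counit, linExt_mono, ncard_bijections_nil]
    split_ifs <;> simp
  | cons d A F hA hF =>
    rw [pairing_cons, ← List.singleton_append, ncard_bijections_append, Nat.cast_sum]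
    refine Finset.sum_congr rfl fun c _ => ?_
    rw [Nat.cast_mul, hF, gamma, linExt_mono]
    congr 1
    -- The cases in which γ_d does or does not vanish on the pruned forest are those in which the
    -- image of the root is excluded or available.
    split_ifs with h
    · rw [hA, ← ncard_bijections_tree_snoc d, List.dropLast_append_getLast? _ h]
    · rw [bijections_tree_eq_empty d A _ h]
      simp
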